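/- All graphs are finite and simple. A \emph{drawing} of a graph $G$ is an injective map $\pi\colon V(G)\to\mathbb{R}^2$, where each edge $uv$ is drawn as the straight line segment with endpoints $\pi(u)$ and $\pi(v)$. A drawing is \emph{crossing-free} if no vertex lies in the interior of an edge and the interiors of any two distinct edges are disjoint. A graph is \emph{outerplanar} if it has a crossing-free drawing in which all vertices lie on the boundary of the outer (unbounded) face. A drawing is \emph{almost layered} if there are finitely many parallel lines, called \emph{layers}, such that every vertex lies on one of the layers and every edge either lies on one of the layers or connects endvertices lying on two consecutive layers. A graph is \emph{almost layered} if it has a crossing-free almost layered drawing. Every outerplanar graph is almost layered. -/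

import Mathlib

namespace OuterLayered

/-- The Euclidean plane. -/
abbrev Plane : Type := EuclideanSpace ℝ (Fin 2)

/-- A (straight-line) drawing of a graph with vertex set `V` is an injective placement of the
vertices; the edge `uv` is then drawn as the segment from `π u` to `π v`. It is crossing-free if no
vertex lies in the interior of an edge, and the interiors of two distinct edges are disjoint
(so that two distinct edges can only meet in a common endpoint). -/
structure IsCrossingFreeDrawing {V : Type*} (G : SimpleGraph V) (π : V → Plane) : Prop where
  injective : Function.Injective π
  vertex_notMem : ∀ u v w : V, G.Adj u v → π w ∉ openSegment ℝ (π u) (π v)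
  edges_disjoint : ∀ u v x y : V, G.Adj u v → G.Adj x y → s(u, v) ≠ s(x, y) →
    Disjoint (openSegment ℝ (π u) (π v)) (openSegment ℝ (π x) (π y))

/-- The set of all points of the plane covered by the drawing `π`: all vertices and all edges. -/
def support {V : Type*} (G : SimpleGraph V) (π : V → Plane) : Set Plane :=
  Set.range π ∪ {p | ∃ u v : V, G.Adj u v ∧ p ∈ segment ℝ (π u) (π v)}

/-- The outer face of the drawing `π`: the unbounded connected component of the complement of its
support (there is exactly one when `V` is finite). -/
def outerFace {V : Type*} (G : SimpleGraph V) (π : V → Plane) : Set Plane :=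
  {p | p ∈ (support G π)ᶜ ∧
    ¬ Bornology.IsBounded (connectedComponentIn (support G π)ᶜ p)}

/-- A graph is outerplanar if it has a crossing-free drawing in which every vertex lies on (the
boundary of) the outer face. -/
def IsOuterplanar {V : Type*} (G : SimpleGraph V) : Prop :=
  ∃ π : V → Plane, IsCrossingFreeDrawing G π ∧ ∀ v : V, π v ∈ frontier (outerFace G π)

/-- The line `{p | ⟪n, p⟫ = t}` with normal vector `n ≠ 0`. For a fixed `n`, these are the lines
of one parallel class, and they lie in the plane in the order of their parameters `t`. -/
def layer (n : Plane) (t : ℝ) : Set Plane :=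
  {p | inner ℝ n p = t}

/-- A drawing is almost layered if there are parallel lines `ℓ₁, …, ℓₛ`, in this order in the
plane, such that every vertex lies on one of them, and every edge either lies on one of them or
connects vertices on two consecutive ones. -/
def IsAlmostLayeredDrawing {V : Type*} (G : SimpleGraph V) (π : V → Plane) : Prop :=
  ∃ (n : Plane) (s : ℕ) (t : Fin s → ℝ), n ≠ 0 ∧ StrictMono t ∧
    (∀ v : V, ∃ i : Fin s, π v ∈ layer n (t i)) ∧
    ∀ u v : V, G.Adj u v →
      (∃ i : Fin s, segment ℝ (π u) (π v) ⊆ layer n (t i)) ∨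
      (∃ i j : Fin s, (i.val + 1 = j.val ∨ j.val + 1 = i.val) ∧
        π u ∈ layer n (t i) ∧ π v ∈ layer n (t j))

/-- A graph is almost layered if it has a crossing-free almost layered drawing. -/
def IsAlmostLayered {V : Type*} (G : SimpleGraph V) : Prop :=
  ∃ π : V → Plane, IsCrossingFreeDrawing G π ∧ IsAlmostLayeredDrawing G π

end OuterLayered

namespace OuterLayered

/-! An outerplanar graph has a linear vertex order `f : V → ℕ` in which no two edges, drawn as arcs
above a line, interleave. Joining consecutive vertices keeps the arcs noncrossing and makes the
graph connected. Let `d` be the distance to the first vertex in this larger graph. The ends of an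
edge have levels differing by at most one, and a vertex under an arc has a larger level than one end
of the arc, because every walk from it to the root passes through an end
(`dist_lt_length_of_below`). With these two properties, placing `v` at `(f v, d v)` creates no
crossings (`IsLevelling.isCrossingFreeDrawing`), and the layers are the horizontal lines at integer
heights.

The order is built in `exists_noncrossingOn` from two excluded configurations, `ThetaFree` and
`CrossedCycleFree`, by induction on vertex sets. A set that splits into parts sharing at most one
vertex is handled by gluing the orders of the parts. Otherwise a longest cycle visits every vertex,
since an ear would yield a longer cycle or a theta; the order along that cycle works because its
chords do not cross.

The exclusions use a parity argument in place of the Jordan curve theorem. The parity of crossings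
of the upward ray from `p` with a closed walk is locally constant off the walk and zero on the outer
face. Hence it vanishes at every vertex off the walk, and on every edge with an endpoint off the
walk. In a theta graph, however, the parities of the three paths, each taken relative to the cycle
formed by the other two, add up to one (`theta_parity`). -/

open Filter Topology

/-! ### Crossing parity of an upward ray with one segment -/

/-- A linear coordinate on the plane, the first coordinate after a shear. -/
def xc (t : ℝ) (p : Plane) : ℝ := p 0 + t * p 1

/-- The height of the line through `u` and `v` above the sheared abscissa of `p`. -/
noncomputable def lineHeight (t : ℝ) (u v p : Plane) : ℝ :=
  u 1 + (v 1 - u 1) / (xc t v - xc t u) * (xc t p - xc t u)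

/-- Whether `p` lies to the right of `u`, as an element of `ZMod 2`. -/
noncomputable def side (t : ℝ) (u p : Plane) : ZMod 2 := if xc t u ≤ xc t p then 1 else 0

/-- The parity of the number of crossings of the ray from `p` upwards with the segment `uv`. -/
noncomputable def crossParity (t : ℝ) (u v p : Plane) : ZMod 2 :=
  if p 1 < lineHeight t u v p then side t u p + side t v p else 0

/-- The jump of the crossing parities near `q` caused by an endpoint `u` above `q`. -/
noncomputable def jump (t : ℝ) (q u p : Plane) : ZMod 2 :=
  if xc t u = xc t q ∧ q 1 < u 1 then side t u p else 0

@[fun_prop] lemma continuous_xc (t : ℝ) : Continuous (xc t) := by unfold xc; fun_prop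

@[fun_prop] lemma continuous_lineHeight (t : ℝ) (u v : Plane) : Continuous (lineHeight t u v) := by
  unfold lineHeight; fun_prop

lemma xc_combo (t a b : ℝ) (u v : Plane) : xc t (a • u + b • v) = a * xc t u + b * xc t v := by
  simp [xc]; ring

lemma ext_xc {t : ℝ} {p q : Plane} (hx : xc t p = xc t q) (hy : p 1 = q 1) : p = q := by
  ext i
  fin_cases i
  · simpa [xc, hy] using hx
  · exact hy

lemma lineHeight_comm {t : ℝ} {u v : Plane} (h : xc t u ≠ xc t v) (p : Plane) :
    lineHeight t u v p = lineHeight t v u p := by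
  have h1 : xc t u - xc t v ≠ 0 := sub_ne_zero.2 h
  have h2 : xc t v - xc t u ≠ 0 := sub_ne_zero.2 h.symm
  unfold lineHeight
  field_simp
  ring

lemma crossParity_comm {t : ℝ} {u v : Plane} (h : xc t u ≠ xc t v) (p : Plane) :
    crossParity t u v p = crossParity t v u p := by
  unfold crossParity
  rw [lineHeight_comm h, add_comm]

lemma lineHeight_left {t : ℝ} {u v p : Plane} (h : xc t u = xc t p) :
    lineHeight t u v p = u 1 := by
  simp [lineHeight, h]

lemma lineHeight_right {t : ℝ} {u v p : Plane} (huv : xc t u ≠ xc t v) (h : xc t v = xc t p) :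
    lineHeight t u v p = v 1 := by
  rw [lineHeight_comm huv, lineHeight_left h]

lemma exists_combo_of_between {t : ℝ} {u v p : Plane} (huv : xc t u < xc t v)
    (hu : xc t u ≤ xc t p) (hv : xc t p ≤ xc t v) : ∃ a b : ℝ, 0 ≤ a ∧ 0 ≤ b ∧ a + b = 1 ∧
      a * xc t u + b * xc t v = xc t p ∧ lineHeight t u v p = a * u 1 + b * v 1 := by
  have h : 0 < xc t v - xc t u := sub_pos.2 huv
  refine ⟨(xc t v - xc t p) / (xc t v - xc t u), (xc t p - xc t u) / (xc t v - xc t u),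
    div_nonneg (by linarith) h.le, div_nonneg (by linarith) h.le, ?_, ?_, ?_⟩
  · field_simp; ring
  · field_simp; ring
  · unfold lineHeight; field_simp; ring

lemma lineHeight_ne_of_notMem {t : ℝ} {u v p : Plane} (huv : xc t u < xc t v)
    (hu : xc t u ≤ xc t p) (hv : xc t p ≤ xc t v) (hp : p ∉ segment ℝ u v) :
    p 1 ≠ lineHeight t u v p := by
  obtain ⟨a, b, ha, hb, hab, hx, hy⟩ := exists_combo_of_between huv hu hv
  intro h
  refine hp ⟨a, b, ha, hb, hab, ext_xc (t := t) ?_ ?_⟩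
  · rw [xc_combo, hx]
  · rw [h, hy]; simp

lemma side_eventually {t : ℝ} {u q : Plane} (h : xc t u ≠ xc t q) :
    ∀ᶠ p in 𝓝 q, side t u p = side t u q := by
  rcases lt_or_gt_of_ne h with h | h
  · filter_upwards [(continuous_xc t).continuousAt.eventually (lt_mem_nhds h)] with p hp
    simp [side, h.le, hp.le]
  · filter_upwards [(continuous_xc t).continuousAt.eventually (gt_mem_nhds h)] with p hp
    simp [side, not_le.2 h, not_le.2 hp]

lemma below_eventually {t : ℝ} {u v q : Plane} (h : q 1 ≠ lineHeight t u v q) :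
    ∀ᶠ p in 𝓝 q, (p 1 < lineHeight t u v p ↔ q 1 < lineHeight t u v q) := by
  have hc : Continuous fun p : Plane => lineHeight t u v p - p 1 := by fun_prop
  rcases lt_or_gt_of_ne h with h | h
  · filter_upwards [hc.continuousAt.eventually (lt_mem_nhds (sub_pos.2 h))] with p hp
    simp [h, sub_pos.1 hp]
  · filter_upwards [hc.continuousAt.eventually (gt_mem_nhds (sub_neg.2 h))] with p hp
    simp [not_lt.2 h.le, not_lt.2 (sub_neg.1 hp).le]

/-- The parity can change near `q` only through an endpoint vertically above `q`, and `jump` records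
exactly that change. Strictly between the endpoints everything is stable; strictly outside, the two
sides agree and cancel. -/
lemma crossParity_eventually_aux {t : ℝ} {u v q : Plane} (huv : xc t u < xc t v)
    (hq : q ∉ segment ℝ u v) : ∀ᶠ p in 𝓝 q,
      crossParity t u v p + (jump t q u p + jump t q v p) =
        crossParity t u v q + (jump t q u q + jump t q v q) := by
  have two : ∀ z : ZMod 2, z + z = 0 := CharTwo.add_self_eq_zero
  by_cases hu : xc t u = xc t q
  · have hne := lineHeight_ne_of_notMem huv hu.le (hu ▸ huv.le) hq
    have hv : xc t v ≠ xc t q := by rw [← hu]; exact huv.ne'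
    filter_upwards [side_eventually hv, below_eventually hne] with p h1 h2
    simp only [crossParity, jump, h1, h2, hu, hv, lineHeight_left hu]
    split_ifs <;> simp_all
    grind
  by_cases hv : xc t v = xc t q
  · have hne := lineHeight_ne_of_notMem huv (hv ▸ huv.le) hv.ge hq
    filter_upwards [side_eventually hu, below_eventually hne] with p h1 h2
    simp only [crossParity, jump, h1, h2, hu, hv, lineHeight_right huv.ne hv]
    split_ifs <;> simp_all
    grind
  by_cases hin : xc t u < xc t q ∧ xc t q < xc t v
  · have hne := lineHeight_ne_of_notMem huv hin.1.le hin.2.le hq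
    filter_upwards [side_eventually hu, side_eventually hv, below_eventually hne] with p h1 h2 h3
    simp only [crossParity, jump, h1, h2, h3, hu, hv]
  · have hs : side t u q = side t v q := by
      unfold side
      grind
    filter_upwards [side_eventually hu, side_eventually hv] with p h1 h2
    simp [crossParity, jump, h1, h2, hu, hv, hs, two]

lemma crossParity_eventually {t : ℝ} {u v q : Plane} (huv : xc t u ≠ xc t v)
    (hq : q ∉ segment ℝ u v) : ∀ᶠ p in 𝓝 q,
      crossParity t u v p + (jump t q u p + jump t q v p) =
        crossParity t u v q + (jump t q u q + jump t q v q) := by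
  rcases lt_or_gt_of_ne huv with h | h
  · exact crossParity_eventually_aux h hq
  · filter_upwards [crossParity_eventually_aux h (segment_symm ℝ u v ▸ hq)] with p hp
    rw [crossParity_comm huv, crossParity_comm huv, add_comm (jump t q u p),
      add_comm (jump t q u q), hp]

lemma crossParity_eq_zero_of_xc {t M : ℝ} {u v p : Plane} (hu : |xc t u| ≤ M)
    (hv : |xc t v| ≤ M) (hp : M < |xc t p|) : crossParity t u v p = 0 := by
  have hs : side t u p = side t v p := by
    unfold side
    rw [abs_le] at hu hv
    rcases lt_abs.1 hp with h | h
    · rw [if_pos (by linarith), if_pos (by linarith)]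
    · rw [if_neg (by linarith), if_neg (by linarith)]
  simp [crossParity, hs, CharTwo.add_self_eq_zero]

lemma side_eq_or_abs_lineHeight_le {t M : ℝ} {u v : Plane} (huv : xc t u ≠ xc t v)
    (hu : |u 1| ≤ M) (hv : |v 1| ≤ M) (p : Plane) :
    side t u p = side t v p ∨ |lineHeight t u v p| ≤ M := by
  wlog h : xc t u < xc t v generalizing u v
  · rw [lineHeight_comm huv, eq_comm]
    exact this huv.symm hv hu (lt_of_le_of_ne (not_lt.1 h) huv.symm)
  by_cases hin : xc t u ≤ xc t p ∧ xc t p ≤ xc t v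
  · obtain ⟨a, b, ha, hb, hab, -, hy⟩ := exists_combo_of_between h hin.1 hin.2
    right
    rw [hy, abs_le]
    rw [abs_le] at hu hv
    constructor <;> nlinarith
  · left
    unfold side
    grind

lemma crossParity_of_above {t M : ℝ} {u v p : Plane} (huv : xc t u ≠ xc t v)
    (hu : |u 1| ≤ M) (hv : |v 1| ≤ M) (hp : M < p 1) : crossParity t u v p = 0 := by
  rcases side_eq_or_abs_lineHeight_le huv hu hv p with h | h
  · simp [crossParity, h, CharTwo.add_self_eq_zero]
  · rw [crossParity, if_neg]
    have := (abs_le.1 h).2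
    linarith

lemma crossParity_of_below {t M : ℝ} {u v p : Plane} (huv : xc t u ≠ xc t v)
    (hu : |u 1| ≤ M) (hv : |v 1| ≤ M) (hp : p 1 < -M) :
    crossParity t u v p = side t u p + side t v p := by
  rcases side_eq_or_abs_lineHeight_le huv hu hv p with h | h
  · simp [crossParity, h, CharTwo.add_self_eq_zero]
  · rw [crossParity, if_pos]
    have := (abs_le.1 h).1
    linarith

lemma isBounded_box (t M : ℝ) : Bornology.IsBounded {p : Plane | |xc t p| ≤ M ∧ |p 1| ≤ M} := by
  refine Metric.isBounded_iff_subset_closedBall 0 |>.2 ⟨2 * (M + |t| * M) + M, ?_⟩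
  rintro p ⟨h1, h2⟩
  rw [mem_closedBall_zero_iff, EuclideanSpace.norm_eq, Fin.sum_univ_two]
  have hM : 0 ≤ M := (abs_nonneg _).trans h1
  have h3 : |p 0| ≤ M + |t| * M := by
    have : p 0 = xc t p - t * p 1 := by simp [xc]
    rw [this]
    refine (abs_sub _ _).trans (add_le_add h1 ?_)
    rw [abs_mul]
    gcongr
  have h4 : 0 ≤ |t| * M := by positivity
  refine Real.sqrt_le_iff.2 ⟨by positivity, ?_⟩
  rw [Real.norm_eq_abs, Real.norm_eq_abs]
  nlinarith [abs_nonneg (p 0), abs_nonneg (p 1)]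

/-! ### Crossing parity of walks and the outer face -/

section Parity

variable {V : Type*} {G : SimpleGraph V} {π : V → Plane} {t : ℝ}

/-- The parity of the number of crossings of the ray from `p` upwards with the edges of a walk. -/
noncomputable def walkParity (t : ℝ) (π : V → Plane) (p : Plane) :
    {a b : V} → G.Walk a b → ZMod 2
  | _, _, .nil => 0
  | _, _, .cons (u := a) (v := b) _ W => crossParity t (π a) (π b) p + walkParity t π p W

@[simp] lemma walkParity_nil (a : V) (p : Plane) :
    walkParity t π p (.nil : G.Walk a a) = 0 := rfl

@[simp] lemma walkParity_cons {a b c : V} (h : G.Adj a b) (W : G.Walk b c) (p : Plane) :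
    walkParity t π p (.cons h W) = crossParity t (π a) (π b) p + walkParity t π p W := rfl

@[simp] lemma walkParity_append {a b c : V} (W : G.Walk a b) (W' : G.Walk b c) (p : Plane) :
    walkParity t π p (W.append W') = walkParity t π p W + walkParity t π p W' := by
  induction W with
  | nil => simp
  | cons h W ih => simp [ih, add_assoc]

lemma walkParity_reverse (ht : ∀ u v, u ≠ v → xc t (π u) ≠ xc t (π v)) {a b : V}
    (W : G.Walk a b) (p : Plane) :
    walkParity t π p W.reverse = walkParity t π p W := by
  induction W with
  | nil => simp
  | cons h W ih => simp [ih, crossParity_comm (ht _ _ h.ne), add_comm]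

/-- An inner vertex of the walk is shared by two consecutive edges, so its jumps cancel modulo 2.
Only the two ends remain, and these cancel for a closed walk. -/
lemma walkParity_eventually (ht : ∀ u v, u ≠ v → xc t (π u) ≠ xc t (π v)) {a b : V}
    (W : G.Walk a b) {q : Plane}
    (hq : ∀ u v, s(u, v) ∈ W.edges → q ∉ segment ℝ (π u) (π v)) :
    ∀ᶠ p in 𝓝 q, walkParity t π p W + (jump t q (π a) p + jump t q (π b) p) =
      walkParity t π q W + (jump t q (π a) q + jump t q (π b) q) := by
  induction W with
  | nil => simp [CharTwo.add_self_eq_zero]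
  | @cons a b c h W ih =>
    filter_upwards [ih fun u v huv => hq u v (by simp [huv]),
      crossParity_eventually (ht _ _ h.ne) (hq a b (by simp))] with p h1 h2
    have two : ∀ z : ZMod 2, z + z = 0 := CharTwo.add_self_eq_zero
    have h3 := two (jump t q (π b) p)
    have h4 := two (jump t q (π b) q)
    simp only [walkParity_cons]
    linear_combination h1 + h2 - h3 + h4

lemma walkParity_closed_eventually (ht : ∀ u v, u ≠ v → xc t (π u) ≠ xc t (π v)) {a : V}
    (W : G.Walk a a) {q : Plane}
    (hq : ∀ u v, s(u, v) ∈ W.edges → q ∉ segment ℝ (π u) (π v)) :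
    ∀ᶠ p in 𝓝 q, walkParity t π p W = walkParity t π q W := by
  filter_upwards [walkParity_eventually ht W hq] with p hp
  simpa [CharTwo.add_self_eq_zero] using hp

lemma walkParity_eq_of_isPreconnected (ht : ∀ u v, u ≠ v → xc t (π u) ≠ xc t (π v)) {a : V}
    (W : G.Walk a a) {S : Set Plane} (hS : IsPreconnected S)
    (hd : ∀ q ∈ S, ∀ u v, s(u, v) ∈ W.edges → q ∉ segment ℝ (π u) (π v)) {p q : Plane}
    (hp : p ∈ S) (hq : q ∈ S) : walkParity t π p W = walkParity t π q W := by
  let _ : TopologicalSpace (ZMod 2) := ⊥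
  have _ : DiscreteTopology (ZMod 2) := ⟨rfl⟩
  refine hS.constant (f := fun p => walkParity t π p W) (fun z hz => ?_) hp hq
  refine ContinuousAt.continuousWithinAt ?_
  refine (continuousAt_const (y := walkParity t π z W)).congr ?_
  filter_upwards [walkParity_closed_eventually ht W (hd z hz)] with p hp using hp.symm

lemma walkParity_eq_zero_of_xc {M : ℝ} (hM : ∀ v, |xc t (π v)| ≤ M) {p : Plane}
    (hp : M < |xc t p|) {a b : V} (W : G.Walk a b) : walkParity t π p W = 0 := by
  induction W with
  | nil => rfl
  | cons h W ih => simp [ih, crossParity_eq_zero_of_xc (hM _) (hM _) hp]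

lemma walkParity_of_above (ht : ∀ u v, u ≠ v → xc t (π u) ≠ xc t (π v)) {M : ℝ}
    (hM : ∀ v, |π v 1| ≤ M) {p : Plane}
    (hp : M < p 1) {a b : V} (W : G.Walk a b) : walkParity t π p W = 0 := by
  induction W with
  | nil => rfl
  | cons h W ih => simp [ih, crossParity_of_above (ht _ _ h.ne) (hM _) (hM _) hp]

/-- Below all vertices, an edge is counted exactly when its ends lie on different sides of `p`, so
the sum telescopes; for a closed walk it is zero. -/
lemma walkParity_of_below (ht : ∀ u v, u ≠ v → xc t (π u) ≠ xc t (π v)) {M : ℝ}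
    (hM : ∀ v, |π v 1| ≤ M) {p : Plane}
    (hp : p 1 < -M) {a b : V} (W : G.Walk a b) :
    walkParity t π p W = side t (π a) p + side t (π b) p := by
  induction W with
  | nil => simp [CharTwo.add_self_eq_zero]
  | @cons a b c h W ih =>
    have := CharTwo.add_self_eq_zero (side t (π b) p)
    simp only [walkParity_cons, ih, crossParity_of_below (ht _ _ h.ne) (hM _) (hM _) hp]
    linear_combination this

lemma segment_subset_support {u v : V} (h : G.Adj u v) :
    segment ℝ (π u) (π v) ⊆ support G π := fun _ hp => Or.inr ⟨u, v, h, hp⟩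

/-- The component of `q` avoids the walk, so the parity is constant on it. Being unbounded, it
leaves a box around all vertices, and outside the box the parity is zero. -/
lemma walkParity_outerFace [Finite V] (ht : ∀ u v, u ≠ v → xc t (π u) ≠ xc t (π v)) {a : V}
    (W : G.Walk a a) {q : Plane} (hq : q ∈ outerFace G π) : walkParity t π q W = 0 := by
  obtain ⟨hq, hb⟩ := hq
  obtain ⟨M₁, h₁⟩ := Finite.exists_le fun v => |xc t (π v)|
  obtain ⟨M₂, h₂⟩ := Finite.exists_le fun v => |π v 1|
  have h₁ : ∀ v, |xc t (π v)| ≤ max M₁ M₂ := fun v => (h₁ v).trans (le_max_left _ _)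
  have h₂ : ∀ v, |π v 1| ≤ max M₁ M₂ := fun v => (h₂ v).trans (le_max_right _ _)
  have hex : ∃ p ∈ connectedComponentIn (support G π)ᶜ q,
      ¬ (|xc t p| ≤ max M₁ M₂ ∧ |p 1| ≤ max M₁ M₂) := by
    by_contra! h
    exact hb ((isBounded_box t _).subset h)
  obtain ⟨p, hp, hpM⟩ := hex
  rw [walkParity_eq_of_isPreconnected ht W isPreconnected_connectedComponentIn ?_
    (mem_connectedComponentIn hq) hp]
  · by_cases hx : |xc t p| ≤ max M₁ M₂
    · have hy := lt_of_not_ge fun h => hpM ⟨hx, h⟩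
      rcases lt_abs.1 hy with hy | hy
      · exact walkParity_of_above ht h₂ hy W
      · rw [walkParity_of_below ht h₂ (by linarith) W, CharTwo.add_self_eq_zero]
    · exact walkParity_eq_zero_of_xc h₁ (not_le.1 hx) W
  · intro z hz u v huv hzs
    exact connectedComponentIn_subset _ _ hz
      (segment_subset_support (W.adj_of_mem_edges huv) hzs)

lemma IsCrossingFreeDrawing.vertex_mem_segment (hπ : IsCrossingFreeDrawing G π) {u v w : V}
    (h : G.Adj u v) (hw : π w ∈ segment ℝ (π u) (π v)) : w = u ∨ w = v := by
  rw [← insert_endpoints_openSegment] at hw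
  rcases hw with hw | hw | hw
  · exact Or.inl (hπ.injective hw)
  · exact Or.inr (hπ.injective hw)
  · exact absurd hw (hπ.vertex_notMem u v w h)

lemma IsCrossingFreeDrawing.vertex_notMem_edges (hπ : IsCrossingFreeDrawing G π) {a b w : V}
    {W : G.Walk a b} (hw : w ∉ W.support) (u v : V) (huv : s(u, v) ∈ W.edges) :
    π w ∉ segment ℝ (π u) (π v) := by
  intro h
  rcases hπ.vertex_mem_segment (W.adj_of_mem_edges huv) h with rfl | rfl
  · exact hw (W.fst_mem_support_of_mem_edges huv)
  · exact hw (W.snd_mem_support_of_mem_edges huv)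

lemma IsCrossingFreeDrawing.openSegment_notMem_edges (hπ : IsCrossingFreeDrawing G π)
    {a b x y : V} {W : G.Walk a b} (hxy : G.Adj x y) (hW : s(x, y) ∉ W.edges) {p : Plane}
    (hp : p ∈ openSegment ℝ (π x) (π y)) (u v : V) (huv : s(u, v) ∈ W.edges) :
    p ∉ segment ℝ (π u) (π v) := by
  intro h
  rw [← insert_endpoints_openSegment] at h
  rcases h with rfl | rfl | h
  · exact hπ.vertex_notMem x y u hxy hp
  · exact hπ.vertex_notMem x y v hxy hp
  · refine Set.disjoint_left.1
      (hπ.edges_disjoint x y u v hxy (W.adj_of_mem_edges huv) ?_) hp h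
    rintro h'
    exact hW (h' ▸ huv)

/-- Vertices on the outer face are not enclosed by closed walks. -/
lemma walkParity_vertex [Finite V] (hπ : IsCrossingFreeDrawing G π)
    (ht : ∀ u v, u ≠ v → xc t (π u) ≠ xc t (π v)) {a v : V} (W : G.Walk a a)
    (hv : π v ∈ frontier (outerFace G π)) (hW : v ∉ W.support) :
    walkParity t π (π v) W = 0 := by
  obtain ⟨q, hq, hqo⟩ := mem_closure_iff_frequently.1 (frontier_subset_closure hv)
    |>.and_eventually (walkParity_closed_eventually ht W (hπ.vertex_notMem_edges hW)) |>.exists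
  rw [← hqo, walkParity_outerFace ht W hq]

lemma walkParity_openSegment_eq (hπ : IsCrossingFreeDrawing G π)
    (ht : ∀ u v, u ≠ v → xc t (π u) ≠ xc t (π v)) {a x y : V} (W : G.Walk a a)
    (hxy : G.Adj x y) (hW : s(x, y) ∉ W.edges) {p q : Plane}
    (hp : p ∈ openSegment ℝ (π x) (π y)) (hq : q ∈ openSegment ℝ (π x) (π y)) :
    walkParity t π p W = walkParity t π q W :=
  walkParity_eq_of_isPreconnected ht W (convex_openSegment _ _).isPreconnected
    (fun _ hz => hπ.openSegment_notMem_edges hxy hW hz) hp hq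

/-- Edges with an endpoint off a closed walk are not enclosed by it. -/
lemma walkParity_openSegment [Finite V] (hπ : IsCrossingFreeDrawing G π)
    (ht : ∀ u v, u ≠ v → xc t (π u) ≠ xc t (π v)) {a x y : V} (W : G.Walk a a)
    (hv : π y ∈ frontier (outerFace G π)) (hxy : G.Adj x y) (hW : y ∉ W.support) {p : Plane}
    (hp : p ∈ openSegment ℝ (π x) (π y)) : walkParity t π p W = 0 := by
  have hW' : s(x, y) ∉ W.edges := fun h => hW (W.snd_mem_support_of_mem_edges h)
  rw [← walkParity_vertex hπ ht W hv hW]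
  refine walkParity_eq_of_isPreconnected (S := insert (π y) (openSegment ℝ (π x) (π y))) ht W ?_ ?_
    (Or.inr hp) (Or.inl rfl)
  · refine (convex_openSegment (𝕜 := ℝ) (π x) (π y)).isPreconnected.subset_closure
      (Set.subset_insert _ _) (Set.insert_subset ?_ subset_closure)
    rw [closure_openSegment]
    exact right_mem_segment ℝ _ _
  · rintro q (rfl | hq)
    · exact hπ.vertex_notMem_edges hW
    · exact hπ.openSegment_notMem_edges hxy hW' hq

end Parity

/-! ### Edges close to a common endpoint, and theta graphs -/

/-- The point dividing the segment `uv` in the ratio `ε : 1 - ε`. -/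
noncomputable def ray (u v : Plane) (ε : ℝ) : Plane := (1 - ε) • u + ε • v

lemma ray_mem_openSegment {u v : Plane} {ε : ℝ} (h0 : 0 < ε) (h1 : ε < 1) :
    ray u v ε ∈ openSegment ℝ u v := ⟨1 - ε, ε, by linarith, h0, by ring, rfl⟩

lemma tendsto_ray (u v : Plane) : Tendsto (ray u v) (𝓝[>] 0) (𝓝 u) := by
  have h : Continuous (ray u v) := by unfold ray; fun_prop
  simpa [ray] using (h.tendsto 0).mono_left nhdsWithin_le_nhds

lemma eventually_mul_lt {x y : ℝ} (hy : 0 < y) : ∀ᶠ ε in 𝓝[>] (0 : ℝ), ε * x < y := by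
  have h : Tendsto (fun ε : ℝ => ε * x) (𝓝[>] 0) (𝓝 (0 * x)) :=
    ((continuous_id.mul continuous_const).tendsto 0).mono_left nhdsWithin_le_nhds
  exact h.eventually (gt_mem_nhds (by simpa using hy))

lemma eventually_unit : ∀ᶠ ε in 𝓝[>] (0 : ℝ), 0 < ε ∧ ε < 1 :=
  Ioo_mem_nhdsGT one_pos

/-- Twice the signed area of the triangle `auv`, in sheared coordinates. -/
def signedArea (t : ℝ) (a u v : Plane) : ℝ :=
  (xc t u - xc t a) * (v 1 - a 1) - (u 1 - a 1) * (xc t v - xc t a)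

/-- Near `a`, the edge towards `v` can lie above the one towards `u` only if both leave `a` on the
same side. Comparing slopes then gives the sign of the area, reversed on the left. -/
lemma crossParity_ray_eventually {t : ℝ} {a u v : Plane} (hu : xc t a ≠ xc t u)
    (hv : xc t a ≠ xc t v) : ∀ᶠ ε in 𝓝[>] (0 : ℝ), crossParity t a v (ray a u ε) =
      if (xc t a < xc t u ∧ xc t a < xc t v ∧ 0 < signedArea t a u v) ∨
        (xc t u < xc t a ∧ xc t v < xc t a ∧ signedArea t a u v < 0) then 1 else 0 := by
  have hx : ∀ ε, xc t (ray a u ε) = xc t a + ε * (xc t u - xc t a) := fun ε => by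
    rw [ray, xc_combo]; ring
  have hy : ∀ ε, ray a u ε 1 = a 1 + ε * (u 1 - a 1) := fun ε => by
    simp [ray]; ring
  have hb : ∀ ε, ray a u ε 1 < lineHeight t a v (ray a u ε) ↔
      ε * (u 1 - a 1) < (v 1 - a 1) / (xc t v - xc t a) * (ε * (xc t u - xc t a)) := fun ε => by
    rw [lineHeight, hx, hy, add_sub_cancel_left, add_lt_add_iff_left]
  rcases lt_or_gt_of_ne hv with hv | hv
  · have hv' : 0 < xc t v - xc t a := sub_pos.2 hv
    filter_upwards [eventually_unit, eventually_mul_lt (x := xc t u - xc t a) hv'] with ε h0 h1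
    have hb' : ray a u ε 1 < lineHeight t a v (ray a u ε) ↔ 0 < signedArea t a u v := by
      rw [hb, div_mul_eq_mul_div, lt_div_iff₀ hv', ← sub_pos,
        ← mul_pos_iff_of_pos_left (b := signedArea t a u v) h0.1, signedArea]
      ring_nf
    have hs : side t v (ray a u ε) = 0 := by
      rw [side, hx, if_neg]; linarith
    have hs' : side t a (ray a u ε) = if xc t a < xc t u then 1 else 0 := by
      rw [side, hx]
      rcases lt_or_gt_of_ne hu with hu | hu
      · rw [if_pos hu, if_pos]; nlinarith
      · rw [if_neg hu.not_gt, if_neg]; nlinarith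
    simp only [crossParity, hb', hs, hs', hv, hv.not_gt]
    rcases lt_or_gt_of_ne hu with hu | hu <;> simp [hu, hu.not_gt]
  · have hv' : 0 < xc t a - xc t v := sub_pos.2 hv
    filter_upwards [eventually_unit, eventually_mul_lt (x := xc t a - xc t u) hv'] with ε h0 h1
    have hb' : ray a u ε 1 < lineHeight t a v (ray a u ε) ↔ signedArea t a u v < 0 := by
      rw [hb, div_mul_eq_mul_div, lt_div_iff_of_neg (by linarith), ← sub_pos,
        ← neg_pos (a := signedArea t a u v),
        ← mul_pos_iff_of_pos_left (b := -signedArea t a u v) h0.1, signedArea]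
      ring_nf
    have hs : side t v (ray a u ε) = 1 := by
      rw [side, hx, if_pos]; linarith
    have hs' : side t a (ray a u ε) = if xc t a < xc t u then 1 else 0 := by
      rw [side, hx]
      rcases lt_or_gt_of_ne hu with hu | hu
      · rw [if_pos hu, if_pos]; nlinarith
      · rw [if_neg hu.not_gt, if_neg]; nlinarith
    simp only [crossParity, hb', hs, hs', hv, hv.not_gt]
    have := CharTwo.add_self_eq_zero (1 : ZMod 2)
    rcases lt_or_gt_of_ne hu with hu | hu <;> simp [hu, hu.not_gt, this]

lemma signedArea_ne_zero {t : ℝ} {a u v : Plane} (hu : xc t a ≠ xc t u)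
    (huv : xc t a < xc t u ↔ xc t a < xc t v) (hv : xc t a ≠ xc t v)
    (hd : Disjoint (openSegment ℝ a u) (openSegment ℝ a v)) : signedArea t a u v ≠ 0 := by
  intro h
  have hu' : xc t u - xc t a ≠ 0 := sub_ne_zero.2 hu.symm
  -- Parameters in the ratio `r` give points of equal abscissa on the two edges; zero area makes
  -- their heights equal too, so the edges would meet.
  set r := (xc t v - xc t a) / (xc t u - xc t a) with hr
  have hr0 : 0 < r := by
    rcases lt_or_gt_of_ne hu with hu | hu
    · exact div_pos (sub_pos.2 (huv.1 hu)) (sub_pos.2 hu)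
    · exact div_pos_of_neg_of_neg (sub_neg.2 (lt_of_le_of_ne (not_lt.1 (fun h => hu.not_gt
        (huv.2 h))) hv.symm)) (sub_neg.2 hu)
  obtain ⟨ε, h0, h1⟩ := (eventually_unit.and (eventually_mul_lt (x := r) one_pos)).exists
  refine Set.disjoint_left.1 hd (ray_mem_openSegment (ε := ε * r) (by nlinarith) h1) ?_
  have : ray a u (ε * r) = ray a v ε := by
    refine ext_xc (t := t) ?_ ?_
    · rw [ray, ray, xc_combo, xc_combo, hr]; field_simp; ring
    · simp only [ray, hr, PiLp.add_apply, PiLp.smul_apply, smul_eq_mul]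
      unfold signedArea at h
      field_simp
      linear_combination -ε * h
  rw [this]
  exact ray_mem_openSegment h0.1 h0.2

/-- Of two edges leaving `a` on the same side, exactly one is above the other; on opposite sides,
neither is. -/
lemma crossParity_pair_eventually {t : ℝ} {a u v : Plane} (hu : xc t a ≠ xc t u)
    (hv : xc t a ≠ xc t v) (hd : Disjoint (openSegment ℝ a u) (openSegment ℝ a v)) :
    ∀ᶠ ε in 𝓝[>] (0 : ℝ),
      crossParity t a v (ray a u ε) + crossParity t a u (ray a v ε) =
        if (xc t a < xc t u ↔ xc t a < xc t v) then 1 else 0 := by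
  filter_upwards [crossParity_ray_eventually hu hv, crossParity_ray_eventually hv hu] with ε h1 h2
  have h3 := signedArea_ne_zero hu (hv := hv) (hd := hd)
  have h4 : signedArea t a v u = - signedArea t a u v := by unfold signedArea; ring
  rw [h1, h2, h4]
  rcases lt_or_gt_of_ne hu with hu | hu <;> rcases lt_or_gt_of_ne hv with hv | hv <;>
    simp only [hu, hv, hu.not_gt, hv.not_gt] <;> simp only [hu, hv, hu.not_gt, hv.not_gt] at h3
  · rcases lt_or_gt_of_ne (h3 trivial) with h | h <;> simp [h, h.not_gt]
  · simp
  · simp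
  · rcases lt_or_gt_of_ne (h3 trivial) with h | h <;> simp [h, h.not_gt]

section Parity

variable {V : Type*} {G : SimpleGraph V} {π : V → Plane} {t : ℝ}

lemma walkParity_tail_eventually (ht : ∀ u v, u ≠ v → xc t (π u) ≠ xc t (π v))
    (hπ : IsCrossingFreeDrawing G π) {a b c : V}
    (R : G.Walk b c) (ha : a ∉ R.support) (d : V) :
    ∀ᶠ ε in 𝓝[>] (0 : ℝ), walkParity t π (ray (π a) (π d) ε) R = walkParity t π (π a) R := by
  have hj : ∀ z ∈ R.support, ∀ p, jump t (π a) (π z) p = 0 := by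
    intro z hz p
    rw [jump, if_neg]
    rintro ⟨h, -⟩
    exact ht z a (by rintro rfl; exact ha hz) h
  filter_upwards [(tendsto_ray (π a) (π d)).eventually
    (walkParity_eventually ht R (hπ.vertex_notMem_edges ha))] with ε hε
  simpa [hj b R.start_mem_support, hj c R.end_mem_support] using hε

/-- In a theta graph, exactly one of the three paths is enclosed by the other two. -/
lemma theta_parity (ht : ∀ u v, u ≠ v → xc t (π u) ≠ xc t (π v))
    (hπ : IsCrossingFreeDrawing G π) {a c a₁ a₂ a₃ : V}
    (h₁ : G.Adj a a₁) (h₂ : G.Adj a a₂) (h₃ : G.Adj a a₃)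
    (h₁₂ : a₁ ≠ a₂) (h₁₃ : a₁ ≠ a₃) (h₂₃ : a₂ ≠ a₃)
    (R₁ : G.Walk a₁ c) (R₂ : G.Walk a₂ c) (R₃ : G.Walk a₃ c)
    (hR₁ : a ∉ R₁.support) (hR₂ : a ∉ R₂.support) (hR₃ : a ∉ R₃.support) {p₁ p₂ p₃ : Plane}
    (hp₁ : p₁ ∈ openSegment ℝ (π a) (π a₁)) (hp₂ : p₂ ∈ openSegment ℝ (π a) (π a₂))
    (hp₃ : p₃ ∈ openSegment ℝ (π a) (π a₃)) :
    (walkParity t π p₁ (.cons h₂ R₂) + walkParity t π p₁ (.cons h₃ R₃)) +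
    (walkParity t π p₂ (.cons h₁ R₁) + walkParity t π p₂ (.cons h₃ R₃)) +
    (walkParity t π p₃ (.cons h₁ R₁) + walkParity t π p₃ (.cons h₂ R₂)) = 1 := by
  -- The parity is constant along an open edge off the cycle, so each test point may be slid towards
  -- `a`.
  have key : ∀ {x y z : V} (hx : G.Adj a x) (hy : G.Adj a y) (hz : G.Adj a z)
      (Ry : G.Walk y c) (Rz : G.Walk z c) (_ : x ≠ y) (_ : x ≠ z) (_ : a ∉ Ry.support)
      (_ : a ∉ Rz.support) {p q : Plane} (_ : p ∈ openSegment ℝ (π a) (π x))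
      (_ : q ∈ openSegment ℝ (π a) (π x)),
      walkParity t π p (.cons hy Ry) + walkParity t π p (.cons hz Rz) =
      walkParity t π q (.cons hy Ry) + walkParity t π q (.cons hz Rz) := by
    intro x y z hx hy hz Ry Rz hxy hxz hRy hRz p q hp hq
    have := walkParity_openSegment_eq hπ ht
      ((SimpleGraph.Walk.cons hy Ry).append (SimpleGraph.Walk.cons hz Rz).reverse) hx ?_ hp hq
    · simpa only [walkParity_append, walkParity_reverse ht] using this
    · have e₁ : s(a, x) ∉ Ry.edges := fun h => hRy (Ry.fst_mem_support_of_mem_edges h)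
      have e₂ : s(a, x) ∉ Rz.edges := fun h => hRz (Rz.fst_mem_support_of_mem_edges h)
      simp [e₁, e₂, hxy, hxz, hx.ne', hy.ne, hz.ne]
  have dis : ∀ {x y : V}, G.Adj a x → G.Adj a y → x ≠ y →
      Disjoint (openSegment ℝ (π a) (π x)) (openSegment ℝ (π a) (π y)) := by
    intro x y hx hy hxy
    exact hπ.edges_disjoint a x a y hx hy (by simp [hxy, hx.ne'])
  obtain ⟨ε, h0, e12, e13, e21, e23, e31, e32, s12, s13, s23⟩ := (eventually_unit.and <|
    (walkParity_tail_eventually ht hπ R₂ hR₂ a₁).and <|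
    (walkParity_tail_eventually ht hπ R₃ hR₃ a₁).and <|
    (walkParity_tail_eventually ht hπ R₁ hR₁ a₂).and <|
    (walkParity_tail_eventually ht hπ R₃ hR₃ a₂).and <|
    (walkParity_tail_eventually ht hπ R₁ hR₁ a₃).and <|
    (walkParity_tail_eventually ht hπ R₂ hR₂ a₃).and <|
    (crossParity_pair_eventually (ht _ _ h₁.ne) (ht _ _ h₂.ne) (dis h₁ h₂ h₁₂)).and <|
    (crossParity_pair_eventually (ht _ _ h₁.ne) (ht _ _ h₃.ne) (dis h₁ h₃ h₁₃)).and <|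
    crossParity_pair_eventually (ht _ _ h₂.ne) (ht _ _ h₃.ne) (dis h₂ h₃ h₂₃)).exists
  have hr : ∀ x, ray (π a) x ε ∈ openSegment ℝ (π a) x := fun x => ray_mem_openSegment h0.1 h0.2
  rw [key h₁ h₂ h₃ R₂ R₃ h₁₂ h₁₃ hR₂ hR₃ hp₁ (hr _),
    key h₂ h₁ h₃ R₁ R₃ h₁₂.symm h₂₃ hR₁ hR₃ hp₂ (hr _),
    key h₃ h₁ h₂ R₁ R₂ h₁₃.symm h₂₃.symm hR₁ hR₂ hp₃ (hr _)]
  simp only [walkParity_cons, e12, e13, e21, e23, e31, e32]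
  have two := CharTwo.add_self_eq_zero (R := ZMod 2)
  -- Three edges leave `a` on two sides, so either one pair or all three pairs share a side: an odd
  -- number.
  have odd : (if (xc t (π a) < xc t (π a₁) ↔ xc t (π a) < xc t (π a₂)) then (1 : ZMod 2) else 0) +
      (if (xc t (π a) < xc t (π a₁) ↔ xc t (π a) < xc t (π a₃)) then 1 else 0) +
      (if (xc t (π a) < xc t (π a₂) ↔ xc t (π a) < xc t (π a₃)) then 1 else 0) = 1 := by
    by_cases x1 : xc t (π a) < xc t (π a₁) <;> by_cases x2 : xc t (π a) < xc t (π a₂) <;>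
      by_cases x3 : xc t (π a) < xc t (π a₃) <;> simp [x1, x2, x3] <;> decide
  have d1 := two (walkParity t π (π a) R₁)
  have d2 := two (walkParity t π (π a) R₂)
  have d3 := two (walkParity t π (π a) R₃)
  rw [← s12, ← s13, ← s23] at odd
  linear_combination odd + d1 + d2 + d3

end Parity

/-! ### Configurations excluded by outerplanarity -/

section Parity

variable {V : Type*} {G : SimpleGraph V} {π : V → Plane} {t : ℝ}

lemma exists_walk_of_isChain {b c : V} {m : List V} (h : List.IsChain G.Adj (b :: (m ++ [c]))) :
    ∃ W : G.Walk b c, W.support = b :: (m ++ [c]) := by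
  induction m generalizing b with
  | nil =>
    have h' : G.Adj b c := by simpa using h
    exact ⟨.cons h' .nil, rfl⟩
  | cons x m ih =>
    rw [List.cons_append, List.isChain_cons_cons] at h
    obtain ⟨W, hW⟩ := ih h.2
    exact ⟨.cons h.1 W, by simp [hW]⟩

lemma openSegment_nonempty (u v : Plane) : (openSegment ℝ u v).Nonempty :=
  ⟨_, ray_mem_openSegment (ε := 1 / 2) (by norm_num) (by norm_num)⟩

lemma parity_add_openSegment [Finite V] (ht : ∀ u v, u ≠ v → xc t (π u) ≠ xc t (π v))
    (hπ : IsCrossingFreeDrawing G π) (hf : ∀ v, π v ∈ frontier (outerFace G π)) {a c x y : V}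
    (W₁ W₂ : G.Walk a c) (hxy : G.Adj x y) (h₁ : y ∉ W₁.support) (h₂ : y ∉ W₂.support)
    {p : Plane} (hp : p ∈ openSegment ℝ (π x) (π y)) :
    walkParity t π p W₁ + walkParity t π p W₂ = 0 := by
  have := walkParity_openSegment hπ ht (W₁.append W₂.reverse) (hf y) hxy ?_ hp
  · simpa only [walkParity_append, walkParity_reverse ht] using this
  · simp [SimpleGraph.Walk.mem_support_append_iff, h₁, h₂]

/-- The chord is the third path of a theta. The first edges of `W₁` and `W₂` contribute zero, since
each ends at a vertex off the other two paths; the chord must contribute the one. -/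
lemma chord_parity [Finite V] (ht : ∀ u v, u ≠ v → xc t (π u) ≠ xc t (π v))
    (hπ : IsCrossingFreeDrawing G π) (hf : ∀ v, π v ∈ frontier (outerFace G π)) {a c : V}
    (W₁ W₂ : G.Walk a c) (hac : G.Adj a c) (ha₁ : a ∉ W₁.support.tail)
    (ha₂ : a ∉ W₂.support.tail) (hd : ∀ x ∈ W₁.support, x ∈ W₂.support → x = a ∨ x = c)
    (he₁ : s(a, c) ∉ W₁.edges) (he₂ : s(a, c) ∉ W₂.edges)
    {p : Plane} (hp : p ∈ openSegment ℝ (π a) (π c)) :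
    walkParity t π p W₁ + walkParity t π p W₂ = 1 := by
  cases W₁ with
  | nil => exact absurd rfl hac.ne
  | @cons _ a₁ _ h₁ R₁ =>
  cases W₂ with
  | nil => exact absurd rfl hac.ne
  | @cons _ a₂ _ h₂ R₂ =>
  have n₁ : a₁ ≠ c := by rintro rfl; simp at he₁
  have n₂ : a₂ ≠ c := by rintro rfl; simp at he₂
  have m₁ : a₁ ∉ (SimpleGraph.Walk.cons h₂ R₂).support := fun h => by
    rcases hd a₁ (by simp) h with h | h
    exacts [h₁.ne' h, n₁ h]
  have m₂ : a₂ ∉ (SimpleGraph.Walk.cons h₁ R₁).support := fun h => by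
    rcases hd a₂ h (by simp) with h | h
    exacts [h₂.ne' h, n₂ h]
  have n₁₂ : a₁ ≠ a₂ := by rintro rfl; simp at m₁
  obtain ⟨p₁, hp₁⟩ := openSegment_nonempty (π a) (π a₁)
  obtain ⟨p₂, hp₂⟩ := openSegment_nonempty (π a) (π a₂)
  have key := theta_parity ht hπ h₁ h₂ hac n₁₂ n₁ n₂ R₁ R₂ .nil (by simpa using ha₁)
    (by simpa using ha₂) (by simpa using hac.ne) hp₁ hp₂ hp
  rwa [parity_add_openSegment ht hπ hf _ _ h₁ m₁ (by simp [h₁.ne', n₁]) hp₁,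
    parity_add_openSegment ht hπ hf _ _ h₂ m₂ (by simp [h₂.ne', n₂]) hp₂, zero_add, zero_add] at key

/-- A graph has no theta subgraphs if no two vertices are joined by three internally disjoint
paths that all have inner vertices. -/
def ThetaFree (G : SimpleGraph V) : Prop :=
  ∀ (a c : V) (l₁ l₂ l₃ : List V), a ≠ c → l₁ ≠ [] → l₂ ≠ [] → l₃ ≠ [] →
    List.IsChain G.Adj (a :: (l₁ ++ [c])) → List.IsChain G.Adj (a :: (l₂ ++ [c])) →
    List.IsChain G.Adj (a :: (l₃ ++ [c])) →
    (∀ x, x ∈ l₁ ∨ x ∈ l₂ ∨ x ∈ l₃ → x ≠ a ∧ x ≠ c) →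
    l₁.Disjoint l₂ → l₁.Disjoint l₃ → l₂.Disjoint l₃ → False

/-- A graph whose cycles have no pairs of crossing chords. -/
def CrossedCycleFree (G : SimpleGraph V) : Prop :=
  ∀ (a b c d : V) (l₁ l₂ l₃ l₄ : List V),
    (a :: (l₁ ++ b :: (l₂ ++ c :: (l₃ ++ d :: l₄)))).Nodup →
    List.IsChain G.Adj (a :: (l₁ ++ b :: (l₂ ++ c :: (l₃ ++ d :: (l₄ ++ [a]))))) →
    G.Adj a c → G.Adj b d → False

/-- Two vertices at different heights exclude exactly one shear, and two at equal heights exclude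
none. -/
lemma exists_generic (hπ : Function.Injective π) [Finite V] :
    ∃ t, ∀ u v, u ≠ v → xc t (π u) ≠ xc t (π v) := by
  have hfin : (Set.range fun z : V × V => -(π z.1 0 - π z.2 0) / (π z.1 1 - π z.2 1)).Finite :=
    Set.finite_range _
  obtain ⟨t, ht⟩ := hfin.infinite_compl.nonempty
  refine ⟨t, fun u v huv h => ht ?_⟩
  have h' : π u 0 - π v 0 + t * (π u 1 - π v 1) = 0 := by
    unfold xc at h
    linear_combination h
  by_cases h1 : π u 1 - π v 1 = 0
  · exact absurd (hπ (ext_xc h (sub_eq_zero.1 h1))) huv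
  · refine ⟨(u, v), ?_⟩
    dsimp only
    rw [div_eq_iff h1]
    linear_combination -h'

/-- The first inner vertex of each path lies off the other two, so all three terms of `theta_parity`
vanish. -/
theorem IsOuterplanar.thetaFree [Finite V] (hG : IsOuterplanar G) : ThetaFree G := by
  obtain ⟨π, hπ, hf⟩ := hG
  obtain ⟨t, ht⟩ := exists_generic hπ.injective
  intro a c l₁ l₂ l₃ hac n₁ n₂ n₃ c₁ c₂ c₃ hm d₁₂ d₁₃ d₂₃
  obtain ⟨a₁, m₁, rfl⟩ := List.exists_cons_of_ne_nil n₁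
  obtain ⟨a₂, m₂, rfl⟩ := List.exists_cons_of_ne_nil n₂
  obtain ⟨a₃, m₃, rfl⟩ := List.exists_cons_of_ne_nil n₃
  rw [List.cons_append, List.isChain_cons_cons] at c₁ c₂ c₃
  obtain ⟨h₁, c₁⟩ := c₁
  obtain ⟨h₂, c₂⟩ := c₂
  obtain ⟨h₃, c₃⟩ := c₃
  obtain ⟨R₁, s₁⟩ := exists_walk_of_isChain c₁
  obtain ⟨R₂, s₂⟩ := exists_walk_of_isChain c₂
  obtain ⟨R₃, s₃⟩ := exists_walk_of_isChain c₃
  simp only [List.disjoint_cons_left, List.disjoint_cons_right, List.mem_cons] at *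
  have e₁ := hm a₁
  have e₂ := hm a₂
  have e₃ := hm a₃
  have e := hm a
  obtain ⟨p₁, hp₁⟩ := openSegment_nonempty (π a) (π a₁)
  obtain ⟨p₂, hp₂⟩ := openSegment_nonempty (π a) (π a₂)
  obtain ⟨p₃, hp₃⟩ := openSegment_nonempty (π a) (π a₃)
  have key := theta_parity ht hπ h₁ h₂ h₃ (by grind) (by grind) (by grind) R₁ R₂ R₃
    (by rw [s₁]; grind) (by rw [s₂]; grind) (by rw [s₃]; grind) hp₁ hp₂ hp₃
  rw [parity_add_openSegment ht hπ hf _ _ h₁ (by simp [s₂]; grind) (by simp [s₃]; grind) hp₁,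
    parity_add_openSegment ht hπ hf _ _ h₂ (by simp [s₁]; grind) (by simp [s₃]; grind) hp₂,
    parity_add_openSegment ht hπ hf _ _ h₃ (by simp [s₁]; grind) (by simp [s₂]; grind) hp₃] at key
  simp at key

/-- The chord `bd` has parity one for the whole cycle. The chord `ac` cuts the cycle into two closed
walks, one missing `d` and the other missing `b`, so `bd` has parity zero for both; the two walks
add up to the cycle modulo 2. -/
theorem IsOuterplanar.crossedCycleFree [Finite V] (hG : IsOuterplanar G) :
    CrossedCycleFree G := by
  obtain ⟨π, hπ, hf⟩ := hG
  obtain ⟨t, ht⟩ := exists_generic hπ.injective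
  intro a b c d l₁ l₂ l₃ l₄ hn hc hac hbd
  obtain ⟨c₁, hc⟩ := List.isChain_cons_split.1 hc
  obtain ⟨c₂, hc⟩ := List.isChain_cons_split.1 hc
  obtain ⟨c₃, c₄⟩ := List.isChain_cons_split.1 hc
  obtain ⟨A, sA⟩ := exists_walk_of_isChain c₁
  obtain ⟨B, sB⟩ := exists_walk_of_isChain c₂
  obtain ⟨C, sC⟩ := exists_walk_of_isChain c₃
  obtain ⟨D, sD⟩ := exists_walk_of_isChain c₄
  obtain ⟨p, hp⟩ := openSegment_nonempty (π b) (π d)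
  have hp' : p ∈ openSegment ℝ (π d) (π b) := by rwa [openSegment_symm]
  simp only [List.nodup_cons, List.nodup_append', List.mem_cons, List.mem_append,
    List.Disjoint] at hn
  have bC : b ∉ C.support := by simp [sC]; grind
  have bD : b ∉ D.support := by simp [sD]; grind
  have dA : d ∉ A.support := by simp [sA]; grind
  have dB : d ∉ B.support := by simp [sB]; grind
  have k₁ := chord_parity ht hπ hf (B.append C) (A.reverse.append D.reverse) hbd
    (by simp [SimpleGraph.Walk.support_append, sB, sC]; grind)
    (by simp [SimpleGraph.Walk.support_append, sA, sD]; grind)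
    (by simp [SimpleGraph.Walk.support_append, sA, sB, sC, sD]; grind)
    (by
      simp only [SimpleGraph.Walk.edges_append, List.mem_append, not_or]
      exact ⟨fun h => dB (B.snd_mem_support_of_mem_edges h),
        fun h => bC (C.fst_mem_support_of_mem_edges h)⟩)
    (by
      simp only [SimpleGraph.Walk.edges_append, SimpleGraph.Walk.edges_reverse, List.mem_append,
        List.mem_reverse, not_or]
      exact ⟨fun h => dA (A.snd_mem_support_of_mem_edges h),
        fun h => bD (D.fst_mem_support_of_mem_edges h)⟩) hp
  have k₂ := parity_add_openSegment ht hπ hf (A.append B) (.cons hac .nil) hbd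
    (by simp [SimpleGraph.Walk.mem_support_append_iff, dA, dB])
    (by simp; grind) hp
  have k₃ := parity_add_openSegment ht hπ hf (C.append D) (.cons hac.symm .nil) hbd.symm
    (by simp [SimpleGraph.Walk.mem_support_append_iff, bC, bD])
    (by simp; grind) hp'
  simp only [walkParity_append, walkParity_reverse ht, walkParity_cons, walkParity_nil] at k₁ k₂ k₃
  rw [crossParity_comm (ht _ _ hac.ne')] at k₃
  have k₄ := CharTwo.add_self_eq_zero (crossParity t (π a) (π c) p)
  exact zero_ne_one (α := ZMod 2) (by linear_combination k₁ - k₂ - k₃ + k₄)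

end Parity

/-! ### A noncrossing linear order -/

section Noncrossing

open scoped Classical in
lemma exists_split_of_idxOf_lt {α : Type*} {l : List α} {a : α} (ha : a ∈ l) :
    ∃ l₀ l₁, l = l₀ ++ a :: l₁ ∧ ∀ z ∈ l, l.idxOf a < l.idxOf z →
      z ∈ l₁ ∧ l.idxOf z = l₁.idxOf z + (l₀.length + 1) := by
  obtain ⟨l₀, l₁, rfl, h⟩ := List.eq_append_cons_of_mem ha
  refine ⟨l₀, l₁, rfl, fun z hz hlt => ?_⟩
  rw [List.idxOf_append, if_neg h, List.idxOf_cons_self, List.idxOf_append] at hlt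
  by_cases hz₀ : z ∈ l₀
  · rw [if_pos hz₀] at hlt
    have := List.idxOf_lt_length_of_mem hz₀
    omega
  · have hza : a ≠ z := by
      rintro rfl
      simp [hz₀] at hlt
    refine ⟨by simpa [hz₀, hza.symm] using hz, ?_⟩
    rw [List.idxOf_append, if_neg hz₀, List.idxOf_cons_ne _ hza]
    omega

variable {V : Type*} {G : SimpleGraph V}

/-- The placement `f` puts the vertices in `s` at distinct points of a line in such a way that
edges drawn as arcs on one side of the line do not cross. -/
def NoncrossingOn (G : SimpleGraph V) (s : Finset V) (f : V → ℕ) : Prop :=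
  Set.InjOn f s ∧ ∀ a ∈ s, ∀ b ∈ s, ∀ c ∈ s, ∀ d ∈ s, f a < f b → f b < f c → f c < f d →
    G.Adj a c → G.Adj b d → False

/-- Whether two arcs interleave depends only on the cyclic order. -/
lemma NoncrossingOn.rotate {s : Finset V} {f : V → ℕ} (hf : NoncrossingOn G s f) (v : V) :
    ∃ g, NoncrossingOn G s g ∧ ∀ x ∈ s, g v ≤ g x := by
  have hM : ∀ x ∈ s, f x < s.sup f + 1 := fun x hx => Nat.lt_succ_of_le (Finset.le_sup hx)
  set M := s.sup f + 1
  refine ⟨fun x => if f x < f v then f x + (M + f v) else f x, ⟨?_, ?_⟩, ?_⟩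
  · intro x hx y hy hxy
    have h1 := hM x hx
    have h2 := hM y hy
    refine hf.1 hx hy ?_
    dsimp only at hxy
    split_ifs at hxy <;> omega
  · intro a ha b hb c hc d hd hab hbc hcd hac hbd
    have h1 := hM a ha
    have h2 := hM b hb
    have h3 := hM c hc
    have h4 := hM d hd
    have k1 := hf.2 a ha b hb c hc d hd
    have k2 := hf.2 d hd a ha b hb c hc
    have k3 := hf.2 c hc d hd a ha b hb
    have k4 := hf.2 b hb c hc d hd a ha
    have := hac.symm
    have := hbd.symm
    dsimp only at hab hbc hcd
    split_ifs at hab hbc hcd <;> grind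
  · intro x hx
    dsimp only
    split_ifs <;> omega

/-- The rest of `B` is placed after `A`. Only edges at `v` can join the two blocks, and `v` comes
first, so they cross nothing. -/
lemma NoncrossingOn.glue [DecidableEq V] {A B : Finset V} {f g : V → ℕ} {v : V}
    (hf : NoncrossingOn G A f) (hg : NoncrossingOn G B g) (hfv : ∀ x ∈ A, f v ≤ f x)
    (hgv : ∀ x ∈ B, g v ≤ g x) (hv : A ∩ B ⊆ {v})
    (hAB : ∀ a ∈ A \ B, ∀ b ∈ B \ A, ¬ G.Adj a b) : ∃ h, NoncrossingOn G (A ∪ B) h := by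
  have hM : ∀ x ∈ A, f x < A.sup f + 1 := fun x hx => Nat.lt_succ_of_le (Finset.le_sup hx)
  set M := A.sup f + 1
  have hv : ∀ x ∈ A, x ∈ B → x = v := fun x h1 h2 => by
    simpa using hv (Finset.mem_inter.2 ⟨h1, h2⟩)
  have hedge : ∀ x ∈ A ∪ B, ∀ y ∈ A ∪ B, G.Adj x y → (x ∈ A ∧ y ∈ A) ∨ (x ∈ B ∧ y ∈ B) := by
    intro x hx y hy hxy
    have h1 := hAB x
    have h2 := hAB y
    have := hxy.symm
    grind
  refine ⟨fun x => if x ∈ A then f x else g x + M, ⟨?_, ?_⟩⟩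
  · intro x hx y hy hxy
    have h1 := @hf.1 x
    have h2 := @hg.1 x
    dsimp only at hxy
    simp only [Finset.coe_union, Set.mem_union, Finset.mem_coe] at *
    split_ifs at hxy <;> grind
  · intro a ha b hb c hc d hd hab hbc hcd hac hbd
    have k1 := hf.2 a
    have k2 := hg.2 a
    have e1 := hedge a ha c hc hac
    have e2 := hedge b hb d hd hbd
    dsimp only at hab hbc hcd
    have i1 := @hf.1 a
    have i2 := @hg.1 a
    by_cases a1 : a ∈ A <;> by_cases b1 : b ∈ A <;> by_cases c1 : c ∈ A <;>
      by_cases d1 : d ∈ A <;> simp only [a1, b1, c1, d1, if_true, if_false] at hab hbc hcd <;> grind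

/-- A decomposition of `s` into two smaller parts that share at most one vertex. -/
def Decomposable (G : SimpleGraph V) [DecidableEq V] (s : Finset V) : Prop :=
  ∃ A B : Finset V, A ⊂ s ∧ B ⊂ s ∧ A ∪ B = s ∧ (A ∩ B).card ≤ 1 ∧
    ∀ a ∈ A \ B, ∀ b ∈ B \ A, ¬ G.Adj a b

/-- A list of distinct vertices of `s`, at least two, in which cyclically consecutive vertices are
adjacent. -/
structure IsCycleIn (G : SimpleGraph V) (s : Finset V) (l : List V) : Prop where
  two_le : 2 ≤ l.length
  nodup : l.Nodup
  chain : Cycle.Chain G.Adj (l : Cycle V)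
  mem : ∀ x ∈ l, x ∈ s

lemma IsCycleIn.of_isRotated {s : Finset V} {l l' : List V} (h : IsCycleIn G s l) (hl : l ~r l') :
    IsCycleIn G s l' where
  two_le := hl.perm.length_eq ▸ h.two_le
  nodup := hl.nodup_iff.1 h.nodup
  chain := by
    rw [← Cycle.coe_eq_coe.2 hl]
    exact h.chain
  mem x hx := h.mem x (hl.mem_iff.2 hx)

lemma exists_isRotated_cons {l : List V} {x : V} (hx : x ∈ l) : ∃ l', l ~r (x :: l') := by
  obtain ⟨s, t, rfl⟩ := List.append_of_mem hx
  exact ⟨t ++ s, List.isRotated_append⟩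

/-- An ear of a cycle in an indecomposable vertex set. -/
lemma exists_ear [DecidableEq V] {s : Finset V} {l : List V} (hs : ¬ Decomposable G s)
    (hl : IsCycleIn G s l) {v : V} (hv : v ∈ s) (hvl : v ∉ l) :
    ∃ x ∈ l, ∃ y ∈ l, ∃ e : List V, x ≠ y ∧ e ≠ [] ∧ e.Nodup ∧ (∀ z ∈ e, z ∈ s ∧ z ∉ l) ∧
      List.IsChain G.Adj (x :: (e ++ [y])) := by
  classical
  let S : Set V := {z | z ∈ s ∧ z ∉ l}
  let K : Finset V := s.filter fun z => ∃ h : z ∈ S, (G.induce S).Reachable ⟨v, hv, hvl⟩ ⟨z, h⟩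
  let N : Finset V := l.toFinset.filter fun x => ∃ k ∈ K, G.Adj x k
  have hKs : K ⊆ s := Finset.filter_subset _ _
  have hKl : ∀ z ∈ K, z ∉ l := fun z hz => (Finset.mem_filter.1 hz).2.1.2
  have hNl : ∀ z ∈ N, z ∈ l := fun z hz => List.mem_toFinset.1 (Finset.mem_filter.1 hz).1
  have hvK : v ∈ K := Finset.mem_filter.2 ⟨hv, ⟨hv, hvl⟩, SimpleGraph.Reachable.refl _⟩
  -- `K` is the component of `v` off the cycle and `N` its attachments. If `N` had at most one
  -- vertex, `K ∪ N` and `s \ K` would decompose `s`.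
  have hN : 1 < N.card := by
    by_contra hN
    refine hs ⟨K ∪ N, s \ K, ?_, ?_, ?_, ?_, ?_⟩
    · refine Finset.ssubset_iff_subset_ne.2 ⟨Finset.union_subset hKs fun z hz =>
        hl.mem z (hNl z hz), fun h => hN ?_⟩
      have hsub : l.toFinset ⊆ N := by
        intro z hz
        have hz := List.mem_toFinset.1 hz
        have : z ∈ K ∪ N := h ▸ hl.mem z hz
        exact (Finset.mem_union.1 this).resolve_left fun h => hKl z h hz
      have := Finset.card_le_card hsub
      rw [List.toFinset_card_of_nodup hl.nodup] at this
      exact lt_of_lt_of_le hl.two_le this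
    · exact Finset.ssubset_iff_subset_ne.2 ⟨Finset.sdiff_subset, fun h =>
        (Finset.mem_sdiff.1 (h.symm ▸ hv : v ∈ s \ K)).2 hvK⟩
    · ext z
      have := @hKs z
      have := hNl z
      have := hl.mem z
      grind
    · refine (Finset.card_le_card ?_).trans (not_lt.1 hN)
      intro z hz
      grind
    · intro a ha b hb hab
      have haK : a ∈ K := by
        by_contra haK
        have haN : a ∈ N := by grind
        exact (Finset.mem_sdiff.1 ha).2 (Finset.mem_sdiff.2 ⟨hl.mem a (hNl a haN), haK⟩)
      obtain ⟨hbs, hbK⟩ := Finset.mem_sdiff.1 (Finset.mem_sdiff.1 hb).1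
      by_cases hbl : b ∈ l
      · exact (Finset.mem_sdiff.1 hb).2 (Finset.mem_union_right _ (Finset.mem_filter.2
          ⟨List.mem_toFinset.2 hbl, a, haK, hab.symm⟩))
      · obtain ⟨haS, hr⟩ := (Finset.mem_filter.1 haK).2
        refine hbK (Finset.mem_filter.2 ⟨hbs, ⟨hbs, hbl⟩, hr.trans ?_⟩)
        exact SimpleGraph.Adj.reachable (G := G.induce S) (u := ⟨a, haS⟩) (v := ⟨b, hbs, hbl⟩) hab
  obtain ⟨x, hx, y, hy, hxy⟩ := Finset.one_lt_card.1 hN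
  obtain ⟨hxl, k, hk, hxk⟩ := Finset.mem_filter.1 hx
  obtain ⟨hyl, k', hk', hyk⟩ := Finset.mem_filter.1 hy
  obtain ⟨hkS, hr⟩ := (Finset.mem_filter.1 hk).2
  obtain ⟨hkS', hr'⟩ := (Finset.mem_filter.1 hk').2
  obtain ⟨p, hp⟩ := (hr.symm.trans hr').exists_isPath
  let W : G.Walk k k' := p.map (SimpleGraph.Embedding.induce S).toHom
  have hW : W.support = p.support.map Subtype.val := SimpleGraph.Walk.support_map _ _
  refine ⟨x, List.mem_toFinset.1 hxl, y, List.mem_toFinset.1 hyl, W.support, hxy,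
    W.support_ne_nil, ?_, ?_, ?_⟩
  · rw [hW]
    exact hp.support_nodup.map Subtype.val_injective
  · intro z hz
    rw [hW, List.mem_map] at hz
    obtain ⟨w, -, rfl⟩ := hz
    exact w.2
  · have := (SimpleGraph.Walk.cons hxk (W.concat hyk.symm)).isChain_adj_support
    simpa [SimpleGraph.Walk.support_concat] using this

lemma isChain_reverse_path {x y : V} {e : List V} (h : List.IsChain G.Adj (x :: (e ++ [y]))) :
    List.IsChain G.Adj (y :: (e.reverse ++ [x])) := by
  have := List.isChain_reverse.2 (h.imp fun _ _ h => h.symm)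
  simpa using this

/-- A longest cycle in an indecomposable vertex set visits all vertices. -/
lemma IsCycleIn.mem_of_longest [DecidableEq V] (hT : ThetaFree G) {s : Finset V} {l : List V}
    (hs : ¬ Decomposable G s) (hl : IsCycleIn G s l)
    (hmax : ∀ l', IsCycleIn G s l' → l'.length ≤ l.length) {v : V} (hv : v ∈ s) : v ∈ l := by
  by_contra hvl
  obtain ⟨x, hx, y, hy, e, hxy, he, hen, hes, hec⟩ := exists_ear hs hl hv hvl
  obtain ⟨l', hr⟩ := exists_isRotated_cons hx
  obtain ⟨l₁, l₂, rfl⟩ := List.append_of_mem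
    (List.mem_of_ne_of_mem hxy.symm (hr.mem_iff.1 hy))
  have hl' := hl.of_isRotated hr
  have hlen := hr.perm.length_eq
  have hel : ∀ z ∈ e, z ∉ x :: (l₁ ++ y :: l₂) := fun z hz h => (hes z hz).2 (hr.mem_iff.2 h)
  have hes : ∀ z ∈ e, z ∈ s := fun z hz => (hes z hz).1
  have hmem := hl'.mem
  have hnd := hl'.nodup
  have hch := hl'.chain
  rw [Cycle.chain_coe_cons, List.append_assoc, List.cons_append, List.isChain_cons_split] at hch
  obtain ⟨hc₁, hc₂⟩ := hch
  have hpos := List.length_pos_iff.2 he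
  simp only [List.nodup_cons, List.nodup_append', List.mem_cons, List.mem_append,
    List.disjoint_cons_right] at hnd hel
  -- An arc without inner vertices can be replaced by the ear, giving a longer cycle; this includes
  -- the degenerate cycle of two vertices. Otherwise both arcs and the ear form a theta.
  by_cases h₁ : l₁ = []
  · subst h₁
    have := hmax (x :: (e ++ y :: l₂)) ⟨by simp; omega, ?_, ?_, ?_⟩
    · simp at this hlen
      omega
    · simp only [List.nodup_cons, List.nodup_append', List.mem_cons, List.mem_append,
        List.Disjoint] at hnd ⊢
      grind
    · rw [Cycle.chain_coe_cons, List.append_assoc, List.cons_append, List.isChain_cons_split]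
      exact ⟨hec, hc₂⟩
    · grind
  by_cases h₂ : l₂ = []
  · subst h₂
    have := hmax (x :: (l₁ ++ y :: e.reverse)) ⟨by simp; omega, ?_, ?_, ?_⟩
    · simp at this hlen
      omega
    · simp only [List.nodup_cons, List.nodup_append', List.mem_cons, List.mem_append,
        List.Disjoint, List.mem_reverse, List.nodup_reverse] at hnd ⊢
      grind
    · rw [Cycle.chain_coe_cons, List.append_assoc, List.cons_append, List.isChain_cons_split]
      exact ⟨hc₁, isChain_reverse_path hec⟩
    · grind
  refine hT x y l₁ l₂.reverse e hxy h₁ (by simpa using h₂) he hc₁ (isChain_reverse_path hc₂) hec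
    ?_ ?_ ?_ ?_ <;> simp only [List.Disjoint, List.mem_reverse] at hnd ⊢ <;> grind

open scoped Classical in
lemma IsCycleIn.noncrossingOn (hC : CrossedCycleFree G) {s : Finset V} {l : List V}
    (hl : IsCycleIn G s l) (hs : ∀ x ∈ s, x ∈ l) : NoncrossingOn G s l.idxOf := by
  refine ⟨fun x hx y hy h => (List.idxOf_inj (hs x hx)).1 h, ?_⟩
  intro a ha b hb c hc d hd hab hbc hcd hac hbd
  dsimp only at hab hbc hcd
  obtain ⟨l₀, m₁, rfl, h⟩ := exists_split_of_idxOf_lt (hs a ha)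
  obtain ⟨b₁, hb'⟩ := h b (hs b hb) hab
  obtain ⟨c₁, hc'⟩ := h c (hs c hc) (hab.trans hbc)
  obtain ⟨d₁, hd'⟩ := h d (hs d hd) (hab.trans (hbc.trans hcd))
  have hbc₁ : m₁.idxOf b < m₁.idxOf c := by omega
  have hcd₁ : m₁.idxOf c < m₁.idxOf d := by omega
  clear h hb' hc' hd' hab hbc hcd
  obtain ⟨l₁, m₂, rfl, h⟩ := exists_split_of_idxOf_lt b₁
  obtain ⟨c₂, hc'⟩ := h c c₁ hbc₁
  obtain ⟨d₂, hd'⟩ := h d d₁ (hbc₁.trans hcd₁)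
  have hcd₂ : m₂.idxOf c < m₂.idxOf d := by omega
  clear h hc' hd'
  obtain ⟨l₂, m₃, rfl, h⟩ := exists_split_of_idxOf_lt c₂
  obtain ⟨d₃, -⟩ := h d d₂ hcd₂
  obtain ⟨l₃, l₄, rfl⟩ := List.append_of_mem d₃
  have hl' := hl.of_isRotated (List.isRotated_append)
  have h₁ := hl'.nodup
  have h₂ := hl'.chain
  rw [List.cons_append, Cycle.chain_coe_cons] at h₂
  refine hC a b c d l₁ l₂ l₃ (l₄ ++ l₀) ?_ ?_ hac hbd
  · simpa using h₁
  · simpa using h₂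

theorem exists_noncrossingOn (hT : ThetaFree G) (hC : CrossedCycleFree G) (s : Finset V) :
    ∃ f, NoncrossingOn G s f := by
  classical
  induction s using Finset.strongInduction with
  | H s ih =>
  by_cases hs1 : s.card ≤ 1
  · refine ⟨fun _ => 0, ?_, fun a _ b _ c _ d _ h => absurd h (lt_irrefl _)⟩
    exact fun x hx y hy _ => Finset.card_le_one.1 hs1 x hx y hy
  obtain ⟨x, hx, y, hy, hxy⟩ := Finset.one_lt_card.1 (not_le.1 hs1)
  by_cases hs : Decomposable G s
  · obtain ⟨A, B, hA, hB, rfl, hAB, hadj⟩ := hs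
    have : Nonempty V := ⟨x⟩
    obtain ⟨v, hv⟩ := Finset.card_le_one_iff_subset_singleton.1 hAB
    obtain ⟨f, hf⟩ := ih A hA
    obtain ⟨g, hg⟩ := ih B hB
    obtain ⟨f', hf', hfv⟩ := hf.rotate v
    obtain ⟨g', hg', hgv⟩ := hg.rotate v
    exact hf'.glue hg' hfv hgv hv hadj
  -- A vertex without neighbours in `s` could be split off.
  have hex : ∃ z ∈ s, G.Adj x z := by
    by_contra! h
    refine hs ⟨{x}, s.erase x, ?_, Finset.erase_ssubset hx, ?_, ?_, ?_⟩
    · rw [Finset.ssubset_iff_subset_ne]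
      exact ⟨by simpa using hx, by rintro rfl; simp at hs1⟩
    · rw [Finset.singleton_union, Finset.insert_erase hx]
    · simp
    · intro a ha b hb
      grind
  obtain ⟨z, hz, hxz⟩ := hex
  -- A single edge counts as a cycle, so a longest one exists.
  have h₀ : IsCycleIn G s [x, z] := ⟨le_rfl, by simp [hxz.ne], by simp [hxz, hxz.symm],
    by simp [hx, hz]⟩
  have hbound : ∀ l, IsCycleIn G s l → l.length ≤ s.card := by
    intro l hl
    rw [← List.toFinset_card_of_nodup hl.nodup]
    exact Finset.card_le_card fun z hz => hl.mem z (List.mem_toFinset.1 hz)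
  have hP : ∃ l, IsCycleIn G s l ∧
      l.length = Nat.findGreatest (fun n => ∃ l, IsCycleIn G s l ∧ l.length = n) s.card :=
    Nat.findGreatest_spec (P := fun n => ∃ l, IsCycleIn G s l ∧ l.length = n)
      (hbound _ h₀) ⟨_, h₀, rfl⟩
  obtain ⟨l, hl, hlen⟩ := hP
  refine ⟨_, hl.noncrossingOn hC fun v hv => hl.mem_of_longest hT hs (fun l' hl' => ?_) hv⟩
  rw [hlen]
  exact Nat.le_findGreatest (hbound l' hl') ⟨l', hl', rfl⟩

end Noncrossing

/-! ### Levels by distance to the first vertex -/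

section Layering

variable {V : Type*} {G : SimpleGraph V} {f : V → ℕ}

/-- The graph `G` together with all edges between vertices that `f` places consecutively. -/
def withConsecutive (G : SimpleGraph V) (f : V → ℕ) : SimpleGraph V where
  Adj x y := G.Adj x y ∨ x ≠ y ∧ ∀ z, ¬ (f x < f z ∧ f z < f y) ∧ ¬ (f y < f z ∧ f z < f x)
  symm := ⟨fun x y h => by
    rcases h with h | ⟨h, h'⟩
    · exact Or.inl h.symm
    · exact Or.inr ⟨h.symm, fun z => (h' z).symm⟩⟩
  loopless := ⟨fun x h => by
    rcases h with h | h
    · exact h.ne rfl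
    · exact h.1 rfl⟩

lemma withConsecutive_noncrossing
    (hf : ∀ a b c d, f a < f b → f b < f c → f c < f d → G.Adj a c → G.Adj b d → False)
    {a b c d : V} (hab : f a < f b) (hbc : f b < f c) (hcd : f c < f d)
    (hac : (withConsecutive G f).Adj a c) (hbd : (withConsecutive G f).Adj b d) : False := by
  rcases hac with hac | ⟨-, h⟩
  · rcases hbd with hbd | ⟨-, h⟩
    · exact hf a b c d hab hbc hcd hac hbd
    · exact (h c).1 ⟨hbc, hcd⟩
  · exact (h b).1 ⟨hab, hbc⟩

lemma withConsecutive_reachable [Finite V] {r : V} (hr : ∀ x, f r ≤ f x)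
    (hinj : Function.Injective f) (x : V) : (withConsecutive G f).Reachable x r := by
  induction hn : f x using Nat.strong_induction_on generalizing x with
  | _ n ih =>
  subst hn
  by_cases hxr : x = r
  · exact hxr ▸ SimpleGraph.Reachable.refl _
  have hlt : f r < f x := lt_of_le_of_ne (hr x) fun h => hxr (hinj h.symm)
  -- The immediate predecessor of `x` in the order.
  obtain ⟨y, hy, hmax⟩ := Set.exists_max_image {y | f y < f x} f (Set.toFinite _) ⟨r, hlt⟩
  have hadj : (withConsecutive G f).Adj x y := by
    refine Or.inr ⟨?_, fun z => ⟨?_, ?_⟩⟩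
    · rintro rfl
      exact lt_irrefl (f x) hy
    · rintro ⟨h1, h2⟩
      exact lt_asymm hy (h1.trans h2)
    · rintro ⟨h1, h2⟩
      exact absurd (hmax z h2) (not_le.2 h1)
  exact hadj.reachable.trans (ih (f y) hy y rfl)

/-- A walk that leaves the space below an arc passes through an end of the arc. -/
lemma dist_lt_length_of_below
    (hf : ∀ a b c d, f a < f b → f b < f c → f c < f d → G.Adj a c → G.Adj b d → False)
    (hinj : Function.Injective f) {r u w : V} (hr : ∀ x, f r ≤ f x) (huw : G.Adj u w) {x : V}
    (W : (withConsecutive G f).Walk x r) (hux : f u < f x) (hxw : f x < f w) :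
    (withConsecutive G f).dist u r < W.length ∨ (withConsecutive G f).dist w r < W.length := by
  induction W with
  | nil => exact absurd (hr u) (not_le.2 hux)
  | @cons x y r h W ih =>
    rw [SimpleGraph.Walk.length_cons]
    by_cases hyu : y = u
    · subst hyu
      exact Or.inl (Nat.lt_succ_of_le (SimpleGraph.dist_le W))
    by_cases hyw : y = w
    · subst hyw
      exact Or.inr (Nat.lt_succ_of_le (SimpleGraph.dist_le W))
    -- A step to a vertex beyond the arc would cross it, so the walk is still below and induction
    -- applies.
    have huw' : (withConsecutive G f).Adj u w := Or.inl huw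
    rcases lt_or_gt_of_ne fun h => hyu (hinj h) with h1 | h1
    · exact (withConsecutive_noncrossing hf h1 hux hxw h.symm huw').elim
    rcases lt_or_gt_of_ne fun h => hyw (hinj h) with h2 | h2
    · rcases ih hr h1 h2 with h3 | h3
      · exact Or.inl (by omega)
      · exact Or.inr (by omega)
    · exact (withConsecutive_noncrossing hf hux hxw h2 huw' h).elim

lemma exists_level [Finite V]
    (hf : ∀ a b c d, f a < f b → f b < f c → f c < f d → G.Adj a c → G.Adj b d → False)
    (hinj : Function.Injective f) :
    ∃ d : V → ℕ, (∀ u v, G.Adj u v → d u ≤ d v + 1) ∧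
      ∀ u x w, G.Adj u w → f u < f x → f x < f w → d u < d x ∨ d w < d x := by
  rcases isEmpty_or_nonempty V with hV | hV
  · exact ⟨fun _ => 0, fun u => hV.elim u, fun u => hV.elim u⟩
  obtain ⟨r, hr⟩ := Finite.exists_min f
  have hreach := withConsecutive_reachable (G := G) hr hinj
  refine ⟨fun x => (withConsecutive G f).dist x r, fun u v huv => ?_, fun u x w huw hux hxw => ?_⟩
  · obtain ⟨W, hW⟩ := (hreach v).exists_walk_length_eq_dist
    have huv' : (withConsecutive G f).Adj u v := Or.inl huv
    dsimp only
    rw [← hW]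
    exact SimpleGraph.dist_le (W.cons huv')
  · obtain ⟨W, hW⟩ := (hreach x).exists_walk_length_eq_dist
    dsimp only
    rw [← hW]
    exact dist_lt_length_of_below hf hinj hr huw W hux hxw

/-! ### The drawing on the integer grid -/

/-- The placement of the vertices at given integer coordinates. -/
noncomputable def gridDrawing (f d : V → ℕ) (v : V) : Plane := !₂[(f v : ℝ), (d v : ℝ)]

lemma exists_of_mem_openSegment {f d : V → ℕ} {u v : V} {p : Plane}
    (hp : p ∈ openSegment ℝ (gridDrawing f d u) (gridDrawing f d v)) :
    ∃ b : ℝ, 0 < b ∧ b < 1 ∧ p 0 = f u + b * (f v - f u) ∧ p 1 = d u + b * (d v - d u) := by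
  obtain ⟨a, b, ha, hb, hab, rfl⟩ := hp
  obtain rfl : a = 1 - b := by linarith
  refine ⟨b, hb, by linarith, ?_, ?_⟩ <;> simp [gridDrawing] <;> ring

lemma between_of_combo {m n k : ℕ} {b : ℝ} (h0 : 0 < b) (h1 : b < 1) (hmn : m < n)
    (h : (k : ℝ) = m + b * (n - m)) : m < k ∧ k < n := by
  have hmn' : (m : ℝ) < n := by exact_mod_cast hmn
  constructor
  · have : (m : ℝ) < k := by nlinarith
    exact_mod_cast this
  · have : (k : ℝ) < n := by nlinarith
    exact_mod_cast this

/-- The hypotheses under which the drawing with abscissa `f` and ordinate `d` has no crossings. -/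
structure IsLevelling (G : SimpleGraph V) (f d : V → ℕ) : Prop where
  injective : Function.Injective f
  noncrossing : ∀ a b c d, f a < f b → f b < f c → f c < f d → G.Adj a c → G.Adj b d → False
  level_le : ∀ u v, G.Adj u v → d u ≤ d v + 1
  below : ∀ u x w, G.Adj u w → f u < f x → f x < f w → d u < d x ∨ d w < d x

variable {d : V → ℕ}

/-- A slanted edge has no integer height in its interior. A vertex inside a horizontal edge would
lie under its arc at the same level, against `below`. -/
lemma IsLevelling.no_vertex_mem (h : IsLevelling G f d) {u v w : V} (huv : G.Adj u v) {b : ℝ}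
    (h0 : 0 < b) (h1 : b < 1) (hx : (f w : ℝ) = f u + b * (f v - f u))
    (hy : (d w : ℝ) = d u + b * (d v - d u)) : False := by
  wlog hlt : f u < f v generalizing u v b
  · have hne : f v ≠ f u := fun e => huv.ne' (h.injective e)
    exact this huv.symm (b := 1 - b) (by linarith) (by linarith) (by linarith) (by linarith)
      (by omega)
  obtain ⟨h3, h4⟩ := between_of_combo h0 h1 hlt hx
  have h5 := h.below u w v huv h3 h4
  have h6 := h.level_le u v huv
  have h7 := h.level_le v u huv.symm
  rcases lt_trichotomy (d u) (d v) with h8 | h8 | h8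
  · have := between_of_combo h0 h1 h8 hy
    omega
  · rw [h8] at hy
    have : d w = d v := by
      have : (d w : ℝ) = d v := by linarith
      exact_mod_cast this
    omega
  · have := between_of_combo (k := d w) (b := 1 - b) (by linarith) (by linarith) h8 (by linarith)
    omega

/-- Edges between the same two layers do not cross. -/
lemma IsLevelling.no_crossing (h : IsLevelling G f d) {u v x y : V} (huv : G.Adj u v)
    (hxy : G.Adj x y) (hux : d u = d x) (hvy : d v = d y) (hlt : d u < d v)
    (h1 : f u < f x) (h2 : f y < f v) : False := by
  have n := h.noncrossing
  have b := h.below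
  have hinj := h.injective
  have vx : f v ≠ f x := fun e => by rw [hinj e] at hlt; omega
  have uy : f u ≠ f y := fun e => by rw [hinj e] at hlt; omega
  -- By `below`, neither lower end `u`, `x` lies under the other edge's arc. This forces the order
  -- `u, y, v, x`, in which the arcs interleave.
  have a1 := b y u x hxy.symm
  have a2 := b y v x hxy.symm
  have a3 := b u y v huv
  have a4 := b u x v huv
  have a5 := n u y v x
  have a6 := n y u x v
  have := hxy.symm
  have := huv.symm
  grind

/-- Edges on the same layer do not overlap. -/
lemma IsLevelling.no_overlap (h : IsLevelling G f d) {u v x y : V} (huv : G.Adj u v)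
    (hxy : G.Adj x y) (hne : s(u, v) ≠ s(x, y)) (hd : d u = d v) (hd' : d x = d y)
    (hux : d u = d x) {b b' : ℝ} (h0 : 0 < b) (h1 : b < 1) (h0' : 0 < b') (h1' : b' < 1)
    (hX : (f u + b * (f v - f u) : ℝ) = f x + b' * (f y - f x)) : False := by
  wlog huv' : f u < f v generalizing u v b
  · have hne' : f u ≠ f v := fun e => huv.ne (h.injective e)
    exact this huv.symm (by rwa [Sym2.eq_swap]) hd.symm (by omega) (b := 1 - b) (by linarith)
      (by linarith) (by linarith) (by omega)
  wlog hxy' : f x < f y generalizing x y b'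
  · have hne' : f x ≠ f y := fun e => hxy.ne (h.injective e)
    exact this hxy.symm hd'.symm (b' := 1 - b') (by linarith) (by linarith)
      (by rwa [Sym2.eq_swap (a := y)]) (by omega) (by linarith) (by omega)
  have huv₁ : (f u : ℝ) < f v := by exact_mod_cast huv'
  have hxy₁ : (f x : ℝ) < f y := by exact_mod_cast hxy'
  have h2 : f u < f y := by
    have : (f u : ℝ) < f y := by nlinarith
    exact_mod_cast this
  have h3 : f x < f v := by
    have : (f x : ℝ) < f v := by nlinarith
    exact_mod_cast this
  -- An end of one edge strictly inside the other would need a higher level, so both ends coincide.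
  have b1 := h.below u x v huv
  have b2 := h.below x u y hxy
  have b3 := h.below u y v huv
  have b4 := h.below x v y hxy
  have hux' : f u = f x := by omega
  have hvy' : f v = f y := by omega
  exact hne (by rw [h.injective hux', h.injective hvy'])

/-- Heights decide the case: a horizontal and a slanted edge cannot meet, and two slanted ones must
join the same two layers and meet at the same parameter, so their ends are in opposite orders or
coincide. -/
lemma IsLevelling.no_intersection (h : IsLevelling G f d) {u v x y : V} (huv : G.Adj u v)
    (hxy : G.Adj x y) (hne : s(u, v) ≠ s(x, y)) (hd : d u ≤ d v) (hd' : d x ≤ d y) {b b' : ℝ}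
    (h0 : 0 < b) (h1 : b < 1) (h0' : 0 < b') (h1' : b' < 1)
    (hX : (f u + b * (f v - f u) : ℝ) = f x + b' * (f y - f x))
    (hY : (d u + b * (d v - d u) : ℝ) = d x + b' * (d y - d x)) : False := by
  have l1 := h.level_le v u huv.symm
  have l2 := h.level_le y x hxy.symm
  rcases hd.eq_or_lt with e | lt <;> rcases hd'.eq_or_lt with e' | lt'
  · rw [← e, ← e', sub_self, sub_self, mul_zero, mul_zero, add_zero, add_zero] at hY
    exact h.no_overlap huv hxy hne e e' (by exact_mod_cast hY) h0 h1 h0' h1' hX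
  · rw [← e, sub_self, mul_zero, add_zero] at hY
    have := between_of_combo h0' h1' lt' hY
    omega
  · rw [← e', sub_self, mul_zero, add_zero] at hY
    have := between_of_combo h0 h1 lt hY.symm
    omega
  · have e : (d v : ℝ) = d u + 1 := by exact_mod_cast le_antisymm l1 lt
    have e' : (d y : ℝ) = d x + 1 := by exact_mod_cast le_antisymm l2 lt'
    rw [e, e'] at hY
    have k1 : d u < d x + 1 := by
      have : (d u : ℝ) < d x + 1 := by linarith
      exact_mod_cast this
    have k2 : d x < d u + 1 := by
      have : (d x : ℝ) < d u + 1 := by linarith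
      exact_mod_cast this
    have hux : d u = d x := by omega
    have hvy : d v = d y := by omega
    rw [hux] at hY
    obtain rfl : b = b' := by linarith
    rcases lt_trichotomy (f u) (f x) with k | k | k
    · refine h.no_crossing huv hxy hux hvy lt k ?_
      have k' : (f u : ℝ) < f x := by exact_mod_cast k
      have : (f y : ℝ) < f v := by nlinarith
      exact_mod_cast this
    · rw [k] at hX
      have hfv : (f v : ℝ) = f y := mul_left_cancel₀ h0.ne' (by linarith)
      have hfv : f v = f y := by exact_mod_cast hfv
      exact hne (by rw [h.injective k, h.injective hfv])
    · refine h.no_crossing hxy huv hux.symm hvy.symm lt' k ?_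
      have k' : (f x : ℝ) < f u := by exact_mod_cast k
      have : (f v : ℝ) < f y := by nlinarith
      exact_mod_cast this

theorem IsLevelling.isCrossingFreeDrawing (h : IsLevelling G f d) :
    IsCrossingFreeDrawing G (gridDrawing f d) where
  injective u v huv := by
    have := congrArg (fun p : Plane => p 0) huv
    simpa [gridDrawing, h.injective.eq_iff] using this
  vertex_notMem u v w huv hw := by
    obtain ⟨b, h0, h1, hx, hy⟩ := exists_of_mem_openSegment hw
    exact h.no_vertex_mem huv h0 h1 (by simpa [gridDrawing] using hx)
      (by simpa [gridDrawing] using hy)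
  edges_disjoint u v x y huv hxy hne := by
    wlog hd : d u ≤ d v generalizing u v
    · rw [openSegment_symm]
      exact this v u huv.symm (by rwa [Sym2.eq_swap]) (by omega)
    wlog hd' : d x ≤ d y generalizing x y
    · rw [openSegment_symm ℝ (gridDrawing f d x)]
      exact this y x hxy.symm (by rwa [Sym2.eq_swap (a := y)]) (by omega)
    refine Set.disjoint_left.2 fun p hp hp' => ?_
    obtain ⟨b, h0, h1, hx, hy⟩ := exists_of_mem_openSegment hp
    obtain ⟨b', h0', h1', hx', hy'⟩ := exists_of_mem_openSegment hp'
    exact h.no_intersection huv hxy hne hd hd' h0 h1 h0' h1' (hx ▸ hx') (hy ▸ hy')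

theorem IsLevelling.isAlmostLayered [Finite V] (h : IsLevelling G f d) : IsAlmostLayered G := by
  obtain ⟨D, hD⟩ := Finite.exists_le d
  have hin : ∀ p : Plane, inner ℝ (!₂[(0 : ℝ), 1] : Plane) p = p 1 := fun p => by
    simp [PiLp.inner_apply]
  have hmem : ∀ v, gridDrawing f d v ∈ layer !₂[(0 : ℝ), 1] (d v) := fun v => by
    rw [layer, Set.mem_ofPred_eq, hin]
    simp [gridDrawing]
  have hlt : ∀ v, d v < D + 1 := fun v => Nat.lt_succ_of_le (hD v)
  refine ⟨gridDrawing f d, h.isCrossingFreeDrawing, !₂[(0 : ℝ), 1], D + 1, fun i => (i : ℝ), ?_,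
    ?_, fun v => ⟨⟨d v, hlt v⟩, hmem v⟩, fun u v huv => ?_⟩
  · intro h
    have := congrArg (fun p : Plane => p 1) h
    simp at this
  · intro i j hij
    have : i.val < j.val := hij
    dsimp only
    exact_mod_cast this
  · have h1 := h.level_le u v huv
    have h2 := h.level_le v u huv.symm
    by_cases heq : d u = d v
    · left
      refine ⟨⟨d u, hlt u⟩, ?_⟩
      rintro p ⟨a, b, -, -, hab, rfl⟩
      have e1 := hmem u
      have e2 := hmem v
      rw [layer, Set.mem_ofPred_eq] at e1 e2 ⊢
      rw [inner_add_right, inner_smul_right, inner_smul_right, e1, e2, ← heq, ← add_mul, hab,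
        one_mul]
    · exact Or.inr ⟨⟨d u, hlt u⟩, ⟨d v, hlt v⟩, by dsimp only; omega, hmem u, hmem v⟩

end Layering

end OuterLayered

theorem mainTheorem5 {V : Type*} [Finite V] (G : SimpleGraph V)
    (hG : OuterLayered.IsOuterplanar G) : OuterLayered.IsAlmostLayered G := by
  have := Fintype.ofFinite V
  obtain ⟨f, hinj, hf⟩ :=
    OuterLayered.exists_noncrossingOn hG.thetaFree hG.crossedCycleFree Finset.univ
  have hinj : Function.Injective f := fun x y h => hinj (by simp) (by simp) h
  have hf : ∀ a b c d, f a < f b → f b < f c → f c < f d → G.Adj a c → G.Adj b d → False :=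
    fun a b c d => hf a (by simp) b (by simp) c (by simp) d (by simp)
  obtain ⟨d, h1, h2⟩ := OuterLayered.exists_level hf hinj
  exact OuterLayered.IsLevelling.isAlmostLayered ⟨hinj, hf, h1, h2⟩
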